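/- Let $d_1,d_2\in\mathbb{N}$ and let $f:\mathbb{R}^{d_1}\times\mathbb{R}^{d_2}\to\mathbb{R}$ satisfy the following assumptions ($\|\cdot\|$ is the Euclidean norm). 1. $f$ is differentiable and, for some $l>0$, $\|\nabla_x f(x_1,y_1)-\nabla_x f(x_2,y_2)\|\le l\,(\|x_1-x_2\|+\|y_1-y_2\|)$ and $\|\nabla_y f(x_1,y_1)-\nabla_y f(x_2,y_2)\|\le l\,(\|x_1-x_2\|+\|y_1-y_2\|)$ for all $x_1,x_2,y_1,y_2$. 2. For every $x$ the function $f(x,\cdot)$ attains its maximum $\Phi(x)=\max_y f(x,y)$, and for some $\mu$ with $0<\mu\le l$, $\|\nabla_y f(x,y)\|^2\ge 2\mu\,[\Phi(x)-f(x,y)]$ for all $x,y$. Put $\kappa=l/\mu\ge 1$. 3. $\xi$ is a random element of a measurable space $\Xi$, and $G_x(x,y,\xi)$, $G_y(x,y,\xi)$ are jointly measurable, square-integrable estimators with $\mathbb{E}\,G_x(x,y,\xi)=\nabla_x f(x,y)$, $\mathbb{E}\,G_y(x,y,\xi)=\nabla_y f(x,y)$, $\mathbb{E}\|G_x(x,y,\xi)-\nabla_x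 f(x,y)\|^2\le\sigma^2$ and $\mathbb{E}\|G_y(x,y,\xi)-\nabla_y f(x,y)\|^2\le\sigma^2$ for all $x,y$, where $\sigma>0$. 4. $\Phi(x)\ge\Phi^*$ for all $x$, where $\Phi^*\in\mathbb{R}$. Given an initial point $(x_0,y_0)$, let $\Delta=\Phi(x_0)-\Phi^*$, assumed positive, and $a_0=\Phi(x_0)-f(x_0,y_0)\ge 0$. For $T\ge 1$, Stoc-AGDA with $$\tau_1=\min\Big\{\frac{\sqrt{\Delta}}{4\sigma\kappa^2\sqrt{Tl}},\frac{1}{68l\kappa^2}\Big\},\qquad \tau_2=\min\Big\{\frac{17\sqrt{\Delta}}{\sigma\sqrt{Tl}},\frac1l\Big\}$$ performs, for $t=0,\dots,T-1$, the updates $$x_{t+1}=x_t-\tau_1G_x(x_t,y_t,\xi_1^t),\qquad y_{t+1}=y_t+\tau_2G_y(x_{t+1},y_t,\xi_2^t),$$ where all the samples $\xi_1^t,\xi_2^t$ are independent copies of $\xi$ (two per iteration). It outputs $(\hat x,\hat y)=(x_R,y_R)$, where $R$ is uniform on $\{0,\dots,T-1\}$ and independent of the samples. There is an absolute constant $C>0$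 such that, in every such setting and for every $\varepsilon>0$ and every $$T\ \ge\ C\left[\Big(1+\frac{a_0}{\Delta}\Big)\frac{l\kappa^2\Delta}{\varepsilon^2}+\Big(1+\frac{a_0}{\Delta}\Big)^2\frac{l\kappa^4\Delta\sigma^2}{\varepsilon^4}\right],$$ the output satisfies $$\mathbb{E}\|\nabla_x f(\hat x,\hat y)\|\le\varepsilon\qquad\text{and}\qquad \mathbb{E}\|\nabla_y f(\hat x,\hat y)\|\le\varepsilon .$$ In particular, whenever $a_0=O(\Delta)$, Stoc-AGDA directly outputs an $\varepsilon$-stationary point of $f$ (in expectation) after $O\big(l\kappa^2\Delta\varepsilon^{-2}+l\kappa^4\Delta\sigma^2\varepsilon^{-4}\big)$ iterations. -/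

import Mathlib

open MeasureTheory ProbabilityTheory
open scoped ENNReal

noncomputable section

namespace MinimaxPL

/-- `ℝ^d` with the Euclidean norm. -/
abbrev Vec (d : ℕ) : Type := EuclideanSpace ℝ (Fin d)

/-- The partial gradient `∇ₓ f(x, y)`. -/
def gradX {d₁ d₂ : ℕ} (f : Vec d₁ → Vec d₂ → ℝ) (x : Vec d₁) (y : Vec d₂) : Vec d₁ :=
  gradient (fun x' => f x' y) x

/-- The partial gradient `∇_y f(x, y)`. -/
def gradY {d₁ d₂ : ℕ} (f : Vec d₁ → Vec d₂ → ℝ) (x : Vec d₁) (y : Vec d₂) : Vec d₂ :=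
  gradient (fun y' => f x y') y

/-- The primal function `Φ(x) = max_y f(x, y)`. It is only used under `PLInY` below, where the
maximum is attained, so that this supremum is the maximum. -/
def primal {d₁ d₂ : ℕ} (f : Vec d₁ → Vec d₂ → ℝ) (x : Vec d₁) : ℝ :=
  ⨆ y : Vec d₂, f x y

/-- `f` is (jointly) differentiable, with partial gradients `l`-Lipschitz in the sense
`‖∇f(x₁, y₁) - ∇f(x₂, y₂)‖ ≤ l (‖x₁ - x₂‖ + ‖y₁ - y₂‖)`. -/
structure LipschitzSmooth {d₁ d₂ : ℕ} (f : Vec d₁ → Vec d₂ → ℝ) (l : ℝ) : Prop where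
  pos : 0 < l
  differentiable : Differentiable ℝ (fun z : Vec d₁ × Vec d₂ => f z.1 z.2)
  lipschitz_gradX : ∀ x₁ x₂ y₁ y₂,
    ‖gradX f x₁ y₁ - gradX f x₂ y₂‖ ≤ l * (‖x₁ - x₂‖ + ‖y₁ - y₂‖)
  lipschitz_gradY : ∀ x₁ x₂ y₁ y₂,
    ‖gradY f x₁ y₁ - gradY f x₂ y₂‖ ≤ l * (‖x₁ - x₂‖ + ‖y₁ - y₂‖)

/-- The Polyak-Łojasiewicz condition in `y` with constant `μ`: for each `x` the maximum of
`f(x, ·)` is attained, and `‖∇_y f(x, y)‖² ≥ 2 μ (max_y f(x, y) - f(x, y))`. -/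
structure PLInY {d₁ d₂ : ℕ} (f : Vec d₁ → Vec d₂ → ℝ) (μ : ℝ) : Prop where
  pos : 0 < μ
  exists_max : ∀ x, ∃ yStar, ∀ y, f x y ≤ f x yStar
  pl : ∀ x y, 2 * μ * (primal f x - f x y) ≤ ‖gradY f x y‖ ^ 2

/-- With `ν` the law of the random sample, `Gx` and `Gy` are unbiased stochastic estimators of the
partial gradients of `f`, with variances at most `σ²`, `σ > 0`. -/
structure StochasticGradients {d₁ d₂ : ℕ} {Ξ : Type*} [MeasurableSpace Ξ]
    (f : Vec d₁ → Vec d₂ → ℝ) (ν : Measure Ξ) (Gx : Vec d₁ → Vec d₂ → Ξ → Vec d₁)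
    (Gy : Vec d₁ → Vec d₂ → Ξ → Vec d₂) (σ : ℝ) : Prop where
  pos : 0 < σ
  measurable_Gx : Measurable (fun p : Vec d₁ × Vec d₂ × Ξ => Gx p.1 p.2.1 p.2.2)
  measurable_Gy : Measurable (fun p : Vec d₁ × Vec d₂ × Ξ => Gy p.1 p.2.1 p.2.2)
  memLp_Gx : ∀ x y, MemLp (Gx x y) 2 ν
  memLp_Gy : ∀ x y, MemLp (Gy x y) 2 ν
  unbiased_Gx : ∀ x y, ∫ s, Gx x y s ∂ν = gradX f x y
  unbiased_Gy : ∀ x y, ∫ s, Gy x y s ∂ν = gradY f x y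
  variance_Gx : ∀ x y, ∫ s, ‖Gx x y s - gradX f x y‖ ^ 2 ∂ν ≤ σ ^ 2
  variance_Gy : ∀ x y, ∫ s, ‖Gy x y s - gradY f x y‖ ^ 2 ∂ν ≤ σ ^ 2

/-- One iteration of Stoc-AGDA, using the two samples `s 0` and `s 1`:
`x⁺ = x - τ₁ Gx(x, y, s 0)` and then `y⁺ = y + τ₂ Gy(x⁺, y, s 1)`. -/
def agdaStep {d₁ d₂ : ℕ} {Ξ : Type*} (Gx : Vec d₁ → Vec d₂ → Ξ → Vec d₁)
    (Gy : Vec d₁ → Vec d₂ → Ξ → Vec d₂) (τ₁ τ₂ : ℝ) (s : Fin 2 → Ξ)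
    (z : Vec d₁ × Vec d₂) : Vec d₁ × Vec d₂ :=
  let x' := z.1 - τ₁ • Gx z.1 z.2 (s 0)
  (x', z.2 + τ₂ • Gy x' z.2 (s 1))

/-- The iterates `(x_t, y_t)`, `t = 0, …, T`, of `T` iterations of Stoc-AGDA from `(x₀, y₀)`. The
samples consumed are `s t j` for `t < T`, `j < 2`: two per iteration. -/
def agdaIterates {d₁ d₂ : ℕ} {Ξ : Type*} (Gx : Vec d₁ → Vec d₂ → Ξ → Vec d₁)
    (Gy : Vec d₁ → Vec d₂ → Ξ → Vec d₂) (τ₁ τ₂ : ℝ) (x₀ : Vec d₁) (y₀ : Vec d₂) {T : ℕ}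
    (s : Fin T → Fin 2 → Ξ) (t : Fin (T + 1)) : Vec d₁ × Vec d₂ :=
  Fin.induction (motive := fun _ => Vec d₁ × Vec d₂) (x₀, y₀)
    (fun i z => agdaStep Gx Gy τ₁ τ₂ (s i) z) t

/-- The randomness of `T` iterations of Stoc-AGDA: all samples are drawn independently with
law `ν`, and the index `R` of the output is uniform on `{0, …, T - 1}` and independent of them. -/
structure AGDARandomness {Ω Ξ : Type*} [MeasurableSpace Ω] [MeasurableSpace Ξ]
    (P : Measure Ω) (ν : Measure Ξ) (T : ℕ) (ξ : Fin T → Fin 2 → Ω → Ξ)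
    (R : Ω → Fin T) : Prop where
  measurable_sample : ∀ t j, Measurable (ξ t j)
  law_sample : ∀ t j, P.map (ξ t j) = ν
  indep_samples : iIndepFun (fun (i : Fin T × Fin 2) => ξ i.1 i.2) P
  measurable_index : Measurable R
  uniform_index : ∀ i : Fin T, P (R ⁻¹' {i}) = (T : ℝ≥0∞)⁻¹
  indep_index : IndepFun R (fun ω t j => ξ t j ω) P

/-- The random output `(x̂, ŷ) = (x_R, y_R)` of Stoc-AGDA. -/
def agdaOutput {d₁ d₂ : ℕ} {Ω Ξ : Type*} (Gx : Vec d₁ → Vec d₂ → Ξ → Vec d₁)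
    (Gy : Vec d₁ → Vec d₂ → Ξ → Vec d₂) (τ₁ τ₂ : ℝ) (x₀ : Vec d₁) (y₀ : Vec d₂) {T : ℕ}
    (ξ : Fin T → Fin 2 → Ω → Ξ) (R : Ω → Fin T) (ω : Ω) : Vec d₁ × Vec d₂ :=
  agdaIterates Gx Gy τ₁ τ₂ x₀ y₀ (fun t j => ξ t j ω) (R ω).castSucc

/-- `τ₁ = min {√Δ / (4 σ κ² √(T l)), 1 / (68 l κ²)}`. -/
def stepX (l κ σ Δ : ℝ) (T : ℕ) : ℝ :=
  min (√Δ / (4 * σ * κ ^ 2 * √(T * l))) (1 / (68 * l * κ ^ 2))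

/-- `τ₂ = min {17 √Δ / (σ √(T l)), 1 / l}`. -/
def stepY (l σ Δ : ℝ) (T : ℕ) : ℝ :=
  min (17 * √Δ / (σ * √(T * l))) (1 / l)

end MinimaxPL

end

/-! The proof is a Lyapunov argument with V = Φ(x) - Φ* + (Φ(x) - f(x, y)) / 8. One iteration with
τ₂ = 68κ²τ₁ and lτ₂ ≤ 1 satisfies E V(next) + τ₁/4 (‖∇ₓf‖² + ‖∇_y f‖²) ≤ V + lτ₂²σ²/8
(`lintegral_potential_step_le`). The ascent step contracts the gap h = Φ - f by 1 - μτ₂ in mean, up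
to noise. This releases a multiple of lκτ₁h, which pays for the error of descending along ∇ₓf
instead of a gradient of Φ, and for ‖∇_y f‖².

Neither differentiability of Φ nor distances to maximizers are needed. The PL inequality bounds Φ
above by a quadratic with some slope g at x (`exists_primal_le`). So δ ↦ Φ(x + δ) - f(x + δ, y) is
nonnegative and lies below a quadratic with value h and slope g - ∇ₓf at 0, which forces ‖g - ∇ₓf‖²
≤ 6lκh (`norm_sq_le_of_quadratic_nonneg`).

Summing the drift over t and averaging over R bounds the mean squared gradients at the output; the
step sizes and the bound on T make this at most ε². -/

namespace MinimaxPL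

/-! ### Quadratic bounds and random displacements -/

section Calculus

variable {E : Type*} [NormedAddCommGroup E] [InnerProductSpace ℝ E]

/-- The descent lemma: a function with `l`-Lipschitz gradient differs from its linearization by at
most `l / 2 * ‖δ‖ ^ 2`. -/
theorem abs_sub_linearization_le [CompleteSpace E] {g : E → ℝ} {l : ℝ} (hg : Differentiable ℝ g)
    (hl : ∀ a b, ‖gradient g a - gradient g b‖ ≤ l * ‖a - b‖) (x δ : E) :
    |g (x + δ) - g x - inner ℝ (gradient g x) δ| ≤ l / 2 * ‖δ‖ ^ 2 := by
  have hd : ∀ t : ℝ, HasDerivAt (fun t : ℝ => g (x + t • δ) - g x - t * inner ℝ (gradient g x) δ)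
      (inner ℝ (gradient g (x + t • δ) - gradient g x) δ) t := by
    intro t
    have h1 := (hg (x + t • δ)).hasGradientAt.hasFDerivAt
    have h2 : HasDerivAt (fun t : ℝ => x + t • δ) δ t := by
      simpa using ((hasDerivAt_id t).smul_const δ).const_add x
    have h3 := h1.comp_hasDerivAt t h2
    have h4 := (h3.sub_const (g x)).sub ((hasDerivAt_id t).mul_const (inner ℝ (gradient g x) δ))
    exact h4.congr_deriv (by simp [inner_sub_left])
  have hB : ∀ t : ℝ, HasDerivAt (fun t : ℝ => l / 2 * ‖δ‖ ^ 2 * t ^ 2) (l * ‖δ‖ ^ 2 * t) t := by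
    intro t
    exact ((hasDerivAt_pow 2 t).const_mul (l / 2 * ‖δ‖ ^ 2)).congr_deriv (by norm_num; ring)
  -- The remainder along t ↦ x + tδ vanishes at 0 and has slope at most l t ‖δ‖², the derivative of
  -- l/2 ‖δ‖² t².
  have := image_norm_le_of_norm_deriv_right_le_deriv_boundary (a := 0) (b := 1)
    (fun t _ => (hd t).continuousAt.continuousWithinAt)
    (fun t _ => (hd t).hasDerivWithinAt) (by simp) hB (fun t ht => by
      have h1 := norm_inner_le_norm (𝕜 := ℝ) (gradient g (x + t • δ) - gradient g x) δ
      have h2 := hl (x + t • δ) x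
      rw [add_sub_cancel_left, norm_smul, Real.norm_of_nonneg ht.1] at h2
      calc _ ≤ _ := h1
        _ ≤ l * (t * ‖δ‖) * ‖δ‖ := by gcongr
        _ = _ := by ring) (Set.right_mem_Icc.2 zero_le_one)
  simpa using this

/-- A quadratic upper bound of a nonnegative function controls its linear coefficient. -/
theorem norm_sq_le_of_quadratic_nonneg {b : E} {c h : ℝ} (hc : 0 < c)
    (hq : ∀ δ : E, 0 ≤ h + inner ℝ b δ + c * ‖δ‖ ^ 2) : ‖b‖ ^ 2 ≤ 4 * c * h := by
  -- This δ minimizes the quadratic.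
  have h1 := hq (-(1 / (2 * c)) • b)
  rw [inner_smul_right, real_inner_self_eq_norm_sq, norm_smul, mul_pow, Real.norm_eq_abs,
    sq_abs] at h1
  have h2 : h + -(1 / (2 * c)) * ‖b‖ ^ 2 + c * ((-(1 / (2 * c))) ^ 2 * ‖b‖ ^ 2)
      = (4 * c * h - ‖b‖ ^ 2) / (4 * c) := by
    field_simp; ring
  rw [h2] at h1
  have := (div_nonneg_iff.1 h1).resolve_right (by rintro ⟨_, h⟩; linarith)
  linarith [this.1]

/-- The expectation of a nonnegative function of a random displacement `τ • Z`, given a quadratic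
upper bound of the function and the mean and variance of `Z`. -/
theorem lintegral_ofReal_quadratic_le [CompleteSpace E] {Ξ : Type*} [MeasurableSpace Ξ]
    {ν : Measure Ξ} [IsProbabilityMeasure ν] {Z : Ξ → E} (hZ : MemLp Z 2 ν) {m : E}
    (hm : ∫ s, Z s ∂ν = m) {σ : ℝ} (hv : ∫ s, ‖Z s - m‖ ^ 2 ∂ν ≤ σ ^ 2) {W : E → ℝ}
    (hW0 : ∀ δ, 0 ≤ W δ) {a c : ℝ} {b : E} (hc : 0 ≤ c)
    (hW : ∀ δ, W δ ≤ a + inner ℝ b δ + c * ‖δ‖ ^ 2) (τ : ℝ) :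
    0 ≤ a + τ * inner ℝ b m + c * τ ^ 2 * (‖m‖ ^ 2 + σ ^ 2) ∧
    ∫⁻ s, ENNReal.ofReal (W (τ • Z s)) ∂ν
      ≤ ENNReal.ofReal (a + τ * inner ℝ b m + c * τ ^ 2 * (‖m‖ ^ 2 + σ ^ 2)) := by
  have hi : Integrable Z ν := hZ.integrable (by norm_num)
  have hib : Integrable (fun s => inner ℝ b (Z s)) ν := hi.const_inner b
  have him : Integrable (fun s => inner ℝ m (Z s)) ν := hi.const_inner m
  have hsq : Integrable (fun s => ‖Z s - m‖ ^ 2) ν := (hZ.sub (memLp_const m)).integrable_norm_pow (by norm_num)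
  have h1 : Integrable (fun s => a - c * τ ^ 2 * ‖m‖ ^ 2 + τ * inner ℝ b (Z s)) ν :=
    (integrable_const _).add (hib.const_mul _)
  have h2 : Integrable (fun s => a - c * τ ^ 2 * ‖m‖ ^ 2 + τ * inner ℝ b (Z s)
      + c * τ ^ 2 * ‖Z s - m‖ ^ 2) ν := h1.add (hsq.const_mul _)
  have hQ : Integrable (fun s => a - c * τ ^ 2 * ‖m‖ ^ 2 + τ * inner ℝ b (Z s)
      + c * τ ^ 2 * ‖Z s - m‖ ^ 2 + 2 * c * τ ^ 2 * inner ℝ m (Z s)) ν := h2.add (him.const_mul _)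
  -- Expanding ‖Z‖² around m leaves only terms whose mean is known or bounded. No measurability of W
  -- is needed, since W is only compared pointwise with this integrable bound.
  have hle : ∀ s, W (τ • Z s) ≤ (a - c * τ ^ 2 * ‖m‖ ^ 2) + τ * inner ℝ b (Z s)
      + c * τ ^ 2 * ‖Z s - m‖ ^ 2 + 2 * c * τ ^ 2 * inner ℝ m (Z s) := by
    intro s
    refine (hW _).trans (le_of_eq ?_)
    rw [inner_smul_right, norm_smul, mul_pow, Real.norm_eq_abs, sq_abs, norm_sub_sq_real,
      real_inner_comm m (Z s)]
    ring
  have hint : ∫ s, (a - c * τ ^ 2 * ‖m‖ ^ 2 + τ * inner ℝ b (Z s) + c * τ ^ 2 * ‖Z s - m‖ ^ 2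
      + 2 * c * τ ^ 2 * inner ℝ m (Z s)) ∂ν
      ≤ a + τ * inner ℝ b m + c * τ ^ 2 * (‖m‖ ^ 2 + σ ^ 2) := by
    rw [integral_add h2 (him.const_mul _), integral_add h1 (hsq.const_mul _),
      integral_add (integrable_const _) (hib.const_mul _), integral_const_mul,
      integral_const_mul, integral_const_mul, integral_const, integral_inner hi,
      integral_inner hi, hm, real_inner_self_eq_norm_sq]
    simp only [probReal_univ, one_smul]
    have : c * τ ^ 2 * ∫ s, ‖Z s - m‖ ^ 2 ∂ν ≤ c * τ ^ 2 * σ ^ 2 := by gcongr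
    linarith
  refine ⟨(integral_nonneg fun s => (hW0 _).trans (hle s)).trans hint,
    (lintegral_mono fun s => ENNReal.ofReal_le_ofReal (hle s)).trans ?_⟩
  rw [← ofReal_integral_eq_lintegral_ofReal hQ
    (Filter.Eventually.of_forall fun s => (hW0 _).trans (hle s))]
  exact ENNReal.ofReal_le_ofReal hint

end Calculus

/-! ### Regularity of the primal function -/

section Primal

variable {d₁ d₂ : ℕ} {f : Vec d₁ → Vec d₂ → ℝ} {l μ : ℝ}

theorem PLInY.bddAbove (hp : PLInY f μ) (x : Vec d₁) : BddAbove (Set.range (f x)) := by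
  obtain ⟨y, hy⟩ := hp.exists_max x
  exact ⟨f x y, by rintro _ ⟨z, rfl⟩; exact hy z⟩

theorem PLInY.le_primal (hp : PLInY f μ) (x : Vec d₁) (y : Vec d₂) : f x y ≤ primal f x :=
  le_ciSup (hp.bddAbove x) y

theorem PLInY.exists_eq_primal (hp : PLInY f μ) (x : Vec d₁) : ∃ y, f x y = primal f x := by
  obtain ⟨y, hy⟩ := hp.exists_max x
  exact ⟨y, le_antisymm (hp.le_primal x y) (ciSup_le hy)⟩

namespace LipschitzSmooth

theorem differentiable_left (hf : LipschitzSmooth f l) (y : Vec d₂) :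
    Differentiable ℝ fun x => f x y :=
  hf.differentiable.comp (differentiable_id.prodMk (differentiable_const y))

theorem differentiable_right (hf : LipschitzSmooth f l) (x : Vec d₁) :
    Differentiable ℝ (f x) :=
  hf.differentiable.comp ((differentiable_const x).prodMk differentiable_id)

theorem abs_left_le (hf : LipschitzSmooth f l) (x δ : Vec d₁) (y : Vec d₂) :
    |f (x + δ) y - f x y - inner ℝ (gradX f x y) δ| ≤ l / 2 * ‖δ‖ ^ 2 :=
  abs_sub_linearization_le (hf.differentiable_left y)
    (fun a b => by simpa [gradX] using hf.lipschitz_gradX a b y y) x δ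

theorem abs_right_le (hf : LipschitzSmooth f l) (x : Vec d₁) (y δ : Vec d₂) :
    |f x (y + δ) - f x y - inner ℝ (gradY f x y) δ| ≤ l / 2 * ‖δ‖ ^ 2 :=
  abs_sub_linearization_le (hf.differentiable_right x)
    (fun a b => by simpa [gradY] using hf.lipschitz_gradY x x a b) y δ

/-- Converse of the PL inequality: Φ(x) - f(x, ·) is nonnegative and has a quadratic upper bound
with slope -∇_y f. In particular ∇_y f vanishes at maximizers. -/
theorem norm_gradY_sq_le (hf : LipschitzSmooth f l) (hp : PLInY f μ) (x : Vec d₁) (y : Vec d₂) :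
    ‖gradY f x y‖ ^ 2 ≤ 2 * l * (primal f x - f x y) := by
  have := norm_sq_le_of_quadratic_nonneg (b := - gradY f x y) (h := primal f x - f x y)
    (half_pos hf.pos) (fun δ => by
      have h1 := (abs_le.1 (hf.abs_right_le x y δ)).1
      have h2 := hp.le_primal x (y + δ)
      rw [inner_neg_left]
      linarith)
  rw [norm_neg] at this
  linarith

/-- The primal function has a quadratic upper bound at every point. -/
theorem exists_primal_le (hf : LipschitzSmooth f l) (hp : PLInY f μ) (hμ : μ ≤ l) (x : Vec d₁) :
    ∃ g : Vec d₁, ∀ δ,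
      primal f (x + δ) ≤ primal f x + inner ℝ g δ + l * (l / μ) * ‖δ‖ ^ 2 := by
  have hl := hf.pos
  have hμ0 := hp.pos
  -- Any maximizer y at x supplies the slope g = ∇ₓf(x, y). Since ∇_y f(x, y) = 0, ‖∇_y f(x + δ, y)‖
  -- ≤ l‖δ‖, and PL at x + δ bounds the gap there.
  obtain ⟨y, hy⟩ := hp.exists_eq_primal x
  have hgy : gradY f x y = 0 := by
    have := hf.norm_gradY_sq_le hp x y
    rw [hy, sub_self, mul_zero] at this
    simpa using le_antisymm this (sq_nonneg _)
  refine ⟨gradX f x y, fun δ => ?_⟩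
  have h1 := (abs_le.1 (hf.abs_left_le x δ y)).2
  have h2 := hp.pl (x + δ) y
  have h3 := hf.lipschitz_gradY (x + δ) x y y
  rw [hgy, sub_zero, add_sub_cancel_left, sub_self, norm_zero, add_zero] at h3
  have h4 : ‖gradY f (x + δ) y‖ ^ 2 ≤ (l * ‖δ‖) ^ 2 := by gcongr
  have h5 : primal f (x + δ) - f (x + δ) y ≤ l * (l / μ) / 2 * ‖δ‖ ^ 2 := by
    have : l * (l / μ) / 2 * ‖δ‖ ^ 2 = (l * ‖δ‖) ^ 2 / (2 * μ) := by field_simp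
    rw [this, le_div_iff₀ (by positivity)]
    linarith
  have h6 : l / 2 * ‖δ‖ ^ 2 ≤ l * (l / μ) / 2 * ‖δ‖ ^ 2 := by
    have : 1 ≤ l / μ := (one_le_div hμ0).2 hμ
    gcongr
    nlinarith
  linarith

/-- A supremum of continuous functions is lower semicontinuous, which handles the uncountable
family. -/
theorem measurable_primal (hf : LipschitzSmooth f l) (hp : PLInY f μ) :
    Measurable (primal f) :=
  (lowerSemicontinuous_ciSup (fun x => hp.bddAbove x)
    (fun y => (hf.differentiable_left y).continuous.lowerSemicontinuous)).measurable

theorem continuous_gradX (hf : LipschitzSmooth f l) :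
    Continuous fun z : Vec d₁ × Vec d₂ => gradX f z.1 z.2 := by
  rw [continuous_iff_continuousAt]
  intro z
  rw [ContinuousAt, tendsto_iff_norm_sub_tendsto_zero]
  refine squeeze_zero (fun _ => norm_nonneg _) (fun w => hf.lipschitz_gradX w.1 z.1 w.2 z.2) ?_
  have : Continuous fun w : Vec d₁ × Vec d₂ => l * (‖w.1 - z.1‖ + ‖w.2 - z.2‖) := by fun_prop
  simpa using this.tendsto z

theorem continuous_gradY (hf : LipschitzSmooth f l) :
    Continuous fun z : Vec d₁ × Vec d₂ => gradY f z.1 z.2 := by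
  rw [continuous_iff_continuousAt]
  intro z
  rw [ContinuousAt, tendsto_iff_norm_sub_tendsto_zero]
  refine squeeze_zero (fun _ => norm_nonneg _) (fun w => hf.lipschitz_gradY w.1 z.1 w.2 z.2) ?_
  have : Continuous fun w : Vec d₁ × Vec d₂ => l * (‖w.1 - z.1‖ + ‖w.2 - z.2‖) := by fun_prop
  simpa using this.tendsto z

end LipschitzSmooth

end Primal

/-! ### Expected drift of the potential -/

/-- The potential `Φ(x) - Φ* + (Φ(x) - f(x, y)) / 8`. -/
noncomputable def potential {d₁ d₂ : ℕ} (f : Vec d₁ → Vec d₂ → ℝ) (Φstar : ℝ)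
    (z : Vec d₁ × Vec d₂) : ℝ :=
  primal f z.1 - Φstar + (primal f z.1 - f z.1 z.2) / 8

section Drift

variable {d₁ d₂ : ℕ} {f : Vec d₁ → Vec d₂ → ℝ} {l μ σ Φstar : ℝ} {Ξ : Type*} [MeasurableSpace Ξ]
  {ν : Measure Ξ} [IsProbabilityMeasure ν] {Gx : Vec d₁ → Vec d₂ → Ξ → Vec d₁}
  {Gy : Vec d₁ → Vec d₂ → Ξ → Vec d₂}

theorem potential_nonneg (hp : PLInY f μ) (hΦ : ∀ x, Φstar ≤ primal f x) (z : Vec d₁ × Vec d₂) :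
    0 ≤ potential f Φstar z := by
  have h1 := hΦ z.1
  have h2 := hp.le_primal z.1 z.2
  unfold potential
  linarith

theorem measurable_potential (hf : LipschitzSmooth f l) (hp : PLInY f μ) :
    Measurable (potential f Φstar) := by
  have h1 : Measurable fun z : Vec d₁ × Vec d₂ => primal f z.1 :=
    (hf.measurable_primal hp).comp measurable_fst
  have h2 := hf.differentiable.continuous.measurable
  exact (h1.sub_const _).add ((h1.sub h2).div_const 8)

/-- The effect of the ascent step in `y` on the expected potential. -/
theorem lintegral_potential_ascent_le (hf : LipschitzSmooth f l) (hp : PLInY f μ)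
    (hG : StochasticGradients f ν Gx Gy σ) (hΦ : ∀ x, Φstar ≤ primal f x) {τ : ℝ} (hτ : 0 < τ)
    (hτl : τ ≤ 1 / l) (x : Vec d₁) (y : Vec d₂) :
    ∫⁻ s, ENNReal.ofReal (potential f Φstar (x, y + τ • Gy x y s)) ∂ν ≤
      ENNReal.ofReal (primal f x - Φstar + (1 - μ * τ) * (primal f x - f x y) / 8
        + l * τ ^ 2 * σ ^ 2 / 16) := by
  have hl := hf.pos
  refine (lintegral_ofReal_quadratic_le (W := fun δ => potential f Φstar (x, y + δ))
    (b := (-(1 / 8 : ℝ)) • gradY f x y) (a := potential f Φstar (x, y)) (c := l / 16)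
    (hG.memLp_Gy x y) (hG.unbiased_Gy x y)
    (hG.variance_Gy x y) (fun δ => potential_nonneg hp hΦ _) (by positivity) (fun δ => ?_)
    τ).2.trans (ENNReal.ofReal_le_ofReal ?_)
  · have h1 := (abs_le.1 (hf.abs_right_le x y δ)).1
    simp only [potential, inner_smul_left]
    norm_num
    linarith
  · rw [inner_smul_left, real_inner_self_eq_norm_sq]
    have h1 := hp.pl x y
    -- The gain τ‖∇_y f‖²/8 loses at most half of itself to the curvature term lτ²‖∇_y f‖²/16; PL
    -- turns the rest into μτ(Φ - f)/8.
    have h2 : l * τ ≤ 1 := by rw [le_div_iff₀ hl] at hτl; linarith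
    have h3 : l * τ * (τ * ‖gradY f x y‖ ^ 2) ≤ 1 * (τ * ‖gradY f x y‖ ^ 2) := by gcongr
    have h4 : τ * (2 * μ * (primal f x - f x y)) ≤ τ * ‖gradY f x y‖ ^ 2 := by gcongr
    simp only [potential]
    norm_num
    nlinarith

/-- The expected decrease of the potential in one iteration. -/
theorem lintegral_potential_step_le (hf : LipschitzSmooth f l) (hp : PLInY f μ) (hμ : μ ≤ l)
    (hG : StochasticGradients f ν Gx Gy σ) (hΦ : ∀ x, Φstar ≤ primal f x) {τ₁ τ₂ : ℝ}
    (hτ : 0 < τ₂) (hτl : τ₂ ≤ 1 / l) (hτ₁ : τ₁ = τ₂ / (68 * (l / μ) ^ 2)) (x : Vec d₁)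
    (y : Vec d₂) :
    (∫⁻ s₀, ∫⁻ s₁, ENNReal.ofReal
        (potential f Φstar (agdaStep Gx Gy τ₁ τ₂ ![s₀, s₁] (x, y))) ∂ν ∂ν)
      + ENNReal.ofReal (τ₁ / 4 * (‖gradX f x y‖ ^ 2 + ‖gradY f x y‖ ^ 2)) ≤
      ENNReal.ofReal (potential f Φstar (x, y)) + ENNReal.ofReal (l * τ₂ ^ 2 * σ ^ 2 / 8) := by
  have hl := hf.pos
  have hμ0 := hp.pos
  obtain ⟨g, hg⟩ := hf.exists_primal_le hp hμ x
  obtain ⟨κ, hκ⟩ : ∃ κ, κ = l / μ := ⟨_, rfl⟩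
  rw [← hκ] at hg hτ₁
  have hκ1 : 1 ≤ κ := by rw [hκ]; exact (one_le_div hμ0).2 hμ
  have hμκ : l = μ * κ := by rw [hκ]; field_simp
  have hτ₁0 : 0 < τ₁ := by rw [hτ₁]; positivity
  have hτ₂ : τ₂ = 68 * κ ^ 2 * τ₁ := by rw [hτ₁]; field_simp
  have hlτ₂ : l * τ₂ ≤ 1 := by rw [le_div_iff₀ hl] at hτl; linarith
  have hμτ : μ * τ₂ ≤ 1 := le_trans (by gcongr) hlτ₂
  have hlκ : l ≤ l * κ := by nlinarith
  have hlκτ : l * κ * τ₁ ≤ 1 / 68 := by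
    have h : l * (68 * κ ^ 2 * τ₁) ≤ 1 := hτ₂ ▸ hlτ₂
    have h' : 0 < l * κ * τ₁ := by positivity
    nlinarith
  set h := primal f x - f x y with hh
  have hh0 : 0 ≤ h := sub_nonneg.2 (hp.le_primal x y)
  set p := gradX f x y with hpdef
  obtain ⟨θ, hθ⟩ : ∃ θ, θ = 1 - μ * τ₂ := ⟨_, rfl⟩
  have hθ0 : 0 ≤ θ := by linarith
  have hθ1 : θ ≤ 1 := by rw [hθ]; nlinarith
  have hgap : ∀ δ, primal f (x + δ) - f (x + δ) y
      ≤ h + inner ℝ (g - p) δ + 3 / 2 * (l * κ) * ‖δ‖ ^ 2 := by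
    intro δ
    have h1 := hg δ
    have h2 := (abs_le.1 (hf.abs_left_le x δ y)).1
    have h3 : l * ‖δ‖ ^ 2 ≤ l * κ * ‖δ‖ ^ 2 := by gcongr
    rw [inner_sub_left]
    linarith
  -- This replaces the usual estimate through the distance from y to the maximizers at x.
  have hgp : ‖g - p‖ ^ 2 ≤ 6 * (l * κ) * h := by
    have := norm_sq_le_of_quadratic_nonneg (c := 3 / 2 * (l * κ)) (by positivity)
      (fun δ => (sub_nonneg.2 (hp.le_primal (x + δ) y)).trans (hgap δ))
    linarith
  -- W is the bound left after averaging over the second sample, as a function of the displacement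
  -- of x. Its curvature lκ + (θ/8)(3/2)lκ is below 3/2 lκ.
  obtain ⟨hnn, hdesc⟩ := lintegral_ofReal_quadratic_le (τ := -τ₁)
    (W := fun δ => primal f (x + δ) - Φstar + θ * (primal f (x + δ) - f (x + δ) y) / 8
        + l * τ₂ ^ 2 * σ ^ 2 / 16)
    (a := primal f x - Φstar + θ * h / 8 + l * τ₂ ^ 2 * σ ^ 2 / 16)
    (b := g + (θ / 8) • (g - p)) (c := 3 / 2 * (l * κ))
    (hG.memLp_Gx x y) (hG.unbiased_Gx x y) (hG.variance_Gx x y)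
    (fun δ => by
      have h1 := hΦ (x + δ)
      have h2 := sub_nonneg.2 (hp.le_primal (x + δ) y)
      have h3 : 0 ≤ l * τ₂ ^ 2 * σ ^ 2 / 16 := by positivity
      have h4 := mul_nonneg hθ0 h2
      linarith)
    (by positivity)
    (fun δ => by
      have h1 := hg δ
      have h2 := mul_le_mul_of_nonneg_left (hgap δ) hθ0
      have h3 : θ * (l * κ * ‖δ‖ ^ 2) ≤ 1 * (l * κ * ‖δ‖ ^ 2) := by gcongr
      have h4 : 0 ≤ l * κ * ‖δ‖ ^ 2 := by positivity
      rw [inner_add_left, real_inner_smul_left]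
      linarith)
  have hnoise : 0 ≤ l * τ₂ ^ 2 * σ ^ 2 / 8 := by positivity
  have hstep := (lintegral_mono (μ := ν) fun s₀ => (show
      ∫⁻ s₁, ENNReal.ofReal (potential f Φstar (agdaStep Gx Gy τ₁ τ₂ ![s₀, s₁] (x, y))) ∂ν ≤ _ by
    have := lintegral_potential_ascent_le hf hp hG hΦ hτ hτl (x + (-τ₁) • Gx x y s₀) y
    rw [← hθ] at this
    simpa [agdaStep, sub_eq_add_neg] using this)).trans hdesc
  refine (add_le_add_left hstep _).trans ?_
  rw [← ENNReal.ofReal_add (potential_nonneg hp hΦ _) hnoise,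
    ← ENNReal.ofReal_add hnn (by positivity)]
  apply ENNReal.ofReal_le_ofReal
  -- Young's inequality: expanding ‖g‖² ≥ 0 gives -⟪g - p, p⟫ ≤ (‖g - p‖² + ‖p‖²)/2.
  have hv : 0 ≤ ‖(g - p) + p‖ ^ 2 := by positivity
  rw [norm_add_sq_real] at hv
  have hin : inner ℝ (g + (θ / 8) • (g - p)) p = (1 + θ / 8) * inner ℝ (g - p) p + ‖p‖ ^ 2 := by
    rw [← real_inner_self_eq_norm_sq, inner_add_left, real_inner_smul_left, inner_sub_left]
    ring
  have hq := hf.norm_gradY_sq_le hp x y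
  rw [← hpdef, hin]
  rw [← hh] at hq
  simp only [potential]
  rw [← hh]
  have hD : 0 ≤ ‖g - p‖ ^ 2 + ‖p‖ ^ 2 := by positivity
  have hQ : 0 ≤ ‖p‖ ^ 2 := by positivity
  generalize inner ℝ (g - p) p = I at *
  generalize ‖g - p‖ ^ 2 = D at *
  generalize ‖p‖ ^ 2 = Q at *
  generalize ‖gradY f x y‖ ^ 2 = Y at *
  have e1 : θ * h = h - 68 * (l * κ * τ₁ * h) := by
    rw [hθ, hτ₂, hμκ]; ring
  have e2 : τ₁ * (-((1 + θ / 8) * I)) ≤ τ₁ * (9 / 16 * (D + Q)) := by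
    gcongr
    nlinarith
  have e3 : l * κ * τ₁ * (τ₁ * Q) ≤ 1 / 68 * (τ₁ * Q) := by gcongr
  -- The noise of the x step fits in the same amount lτ₂²σ²/16 as that of the y step, because 68²/16
  -- = 289 and κ ≥ 1.
  have e4 : 3 / 2 * (l * κ) * τ₁ ^ 2 * σ ^ 2 ≤ l * τ₂ ^ 2 * σ ^ 2 / 16 := by
    have : κ ≤ κ ^ 4 := le_self_pow₀ hκ1 (by norm_num)
    have h1 : l * τ₂ ^ 2 * σ ^ 2 / 16 = 289 * (κ ^ 4 * (l * τ₁ ^ 2 * σ ^ 2)) := by rw [hτ₂]; ring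
    have h2 : κ * (l * τ₁ ^ 2 * σ ^ 2) ≤ κ ^ 4 * (l * τ₁ ^ 2 * σ ^ 2) := by gcongr
    have h3 : 0 ≤ κ * (l * τ₁ ^ 2 * σ ^ 2) := by positivity
    rw [h1]
    linarith
  have e5 : τ₁ * Y ≤ τ₁ * (2 * (l * κ) * h) := by
    gcongr
    exact hq.trans (by gcongr)
  have e6 : τ₁ * D ≤ τ₁ * (6 * (l * κ) * h) := by gcongr
  have e7 : 0 ≤ l * κ * τ₁ * h := by positivity
  have e8 : 0 ≤ τ₁ * Q := by positivity
  -- Budget in units of lκτ₁h: the contraction yields 68/8 = 8.5, while the slope error costs 9/16 ·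
  -- 6 = 3.375 and ‖∇_y f‖² costs 1/2. In units of τ₁‖p‖²: 9/16 + 3/136 + 1/4 < 1.
  linarith

end Drift

end MinimaxPL

namespace MinimaxPL

/-! ### Structure and measurability of the iterates -/

section Iterates

variable {d₁ d₂ : ℕ} {Ξ : Type*} {Gx : Vec d₁ → Vec d₂ → Ξ → Vec d₁}
  {Gy : Vec d₁ → Vec d₂ → Ξ → Vec d₂} {τ₁ τ₂ : ℝ} {x₀ : Vec d₁} {y₀ : Vec d₂} {T : ℕ}

theorem agdaIterates_zero (s : Fin T → Fin 2 → Ξ) :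
    agdaIterates Gx Gy τ₁ τ₂ x₀ y₀ s 0 = (x₀, y₀) := rfl

theorem agdaIterates_succ (s : Fin T → Fin 2 → Ξ) (t : Fin T) :
    agdaIterates Gx Gy τ₁ τ₂ x₀ y₀ s t.succ =
      agdaStep Gx Gy τ₁ τ₂ (s t) (agdaIterates Gx Gy τ₁ τ₂ x₀ y₀ s t.castSucc) := by
  rw [agdaIterates, Fin.induction_succ, agdaIterates]

/-- The `t`-th iterate depends only on the samples of the first `t` iterations. -/
theorem agdaIterates_congr {s s' : Fin T → Fin 2 → Ξ} (t : Fin (T + 1))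
    (h : ∀ i : Fin T, i.castSucc < t → s i = s' i) :
    agdaIterates Gx Gy τ₁ τ₂ x₀ y₀ s t = agdaIterates Gx Gy τ₁ τ₂ x₀ y₀ s' t := by
  induction t using Fin.induction with
  | zero => rfl
  | succ t ih =>
    rw [agdaIterates_succ, agdaIterates_succ, h t Fin.castSucc_lt_succ,
      ih fun i hi => h i (hi.trans Fin.castSucc_lt_succ)]

variable [MeasurableSpace Ξ]

theorem measurable_agdaStep
    (hx : Measurable fun p : Vec d₁ × Vec d₂ × Ξ => Gx p.1 p.2.1 p.2.2)
    (hy : Measurable fun p : Vec d₁ × Vec d₂ × Ξ => Gy p.1 p.2.1 p.2.2) :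
    Measurable fun p : (Fin 2 → Ξ) × (Vec d₁ × Vec d₂) => agdaStep Gx Gy τ₁ τ₂ p.1 p.2 := by
  have h1 : Measurable fun p : (Fin 2 → Ξ) × (Vec d₁ × Vec d₂) =>
      p.2.1 - τ₁ • Gx p.2.1 p.2.2 (p.1 0) :=
    measurable_snd.fst.sub ((hx.comp (measurable_snd.fst.prodMk
      (measurable_snd.snd.prodMk ((measurable_pi_apply 0).comp measurable_fst)))).const_smul τ₁)
  exact h1.prodMk (measurable_snd.snd.add ((hy.comp (h1.prodMk
      (measurable_snd.snd.prodMk ((measurable_pi_apply 1).comp measurable_fst)))).const_smul τ₂))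

theorem measurable_agdaIterates
    (hx : Measurable fun p : Vec d₁ × Vec d₂ × Ξ => Gx p.1 p.2.1 p.2.2)
    (hy : Measurable fun p : Vec d₁ × Vec d₂ × Ξ => Gy p.1 p.2.1 p.2.2) (t : Fin (T + 1)) :
    Measurable fun s : Fin T → Fin 2 → Ξ => agdaIterates Gx Gy τ₁ τ₂ x₀ y₀ s t := by
  induction t using Fin.induction with
  | zero => exact measurable_const
  | succ t ih =>
    simp_rw [agdaIterates_succ]
    exact (measurable_agdaStep hx hy).comp ((measurable_pi_apply t).prodMk ih)

end Iterates

/-! ### Independence, telescoping and the random output -/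

section Randomness

variable {d₁ d₂ : ℕ} {Ω Ξ : Type*} [MeasurableSpace Ω] [MeasurableSpace Ξ]
  {P : Measure Ω} {ν : Measure Ξ} {T : ℕ}
  {ξ : Fin T → Fin 2 → Ω → Ξ} {R : Ω → Fin T}
  {Gx : Vec d₁ → Vec d₂ → Ξ → Vec d₁} {Gy : Vec d₁ → Vec d₂ → Ξ → Vec d₂} {τ₁ τ₂ : ℝ}
  {x₀ : Vec d₁} {y₀ : Vec d₂}

namespace AGDARandomness

theorem measurable_samples (hr : AGDARandomness P ν T ξ R) :
    Measurable fun ω t j => ξ t j ω :=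
  measurable_pi_lambda _ fun t => measurable_pi_lambda _ fun j => hr.measurable_sample t j

theorem map_samples [IsProbabilityMeasure P] (hr : AGDARandomness P ν T ξ R) (t : Fin T) :
    P.map (fun ω => (ξ t 0 ω, ξ t 1 ω)) = ν.prod ν := by
  have h := hr.indep_samples.indepFun (i := (t, 0)) (j := (t, 1)) (by simp)
  rw [(indepFun_iff_map_prod_eq_prod_map_map (hr.measurable_sample t 0).aemeasurable
    (hr.measurable_sample t 1).aemeasurable).1 h, hr.law_sample, hr.law_sample]

/-- The `t`-th iterate is independent of the samples of iteration `t`. -/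
theorem indepFun_iterate [IsProbabilityMeasure ν] (hr : AGDARandomness P ν T ξ R)
    (hx : Measurable fun p : Vec d₁ × Vec d₂ × Ξ => Gx p.1 p.2.1 p.2.2)
    (hy : Measurable fun p : Vec d₁ × Vec d₂ × Ξ => Gy p.1 p.2.1 p.2.2) (t : Fin T) :
    IndepFun (fun ω => agdaIterates Gx Gy τ₁ τ₂ x₀ y₀ (fun t j => ξ t j ω) t.castSucc)
      (fun ω => (ξ t 0 ω, ξ t 1 ω)) P := by
  classical
  obtain ⟨s₀⟩ : Nonempty Ξ := nonempty_of_isProbabilityMeasure ν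
  let A : Finset (Fin T × Fin 2) := Finset.univ.filter fun i => i.1 < t
  let B : Finset (Fin T × Fin 2) := Finset.univ.filter fun i => i.1 = t
  have hAB : Disjoint A B := Finset.disjoint_filter.2 fun i _ h1 h2 => h1.ne h2
  have hB : ∀ j, (t, j) ∈ B := fun j => by simp [B]
  have hind := hr.indep_samples.indepFun_finset A B hAB fun i => hr.measurable_sample i.1 i.2
  -- Samples outside the past are filled with an arbitrary `s₀`; the `t`-th iterate does not see
  -- them.
  let past : (A → Ξ) → Fin T → Fin 2 → Ξ := fun u i j =>
    if h : (i, j) ∈ A then u ⟨(i, j), h⟩ else s₀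
  have hpast : Measurable past := by
    refine measurable_pi_lambda _ fun i => measurable_pi_lambda _ fun j => ?_
    by_cases h : (i, j) ∈ A
    · simpa only [past, h, dite_true] using measurable_pi_apply _
    · simpa only [past, h, dite_false] using measurable_const
  have hc := hind.comp ((measurable_agdaIterates (τ₁ := τ₁) (τ₂ := τ₂) (x₀ := x₀) (y₀ := y₀)
      hx hy t.castSucc).comp hpast)
    (show Measurable fun u : B → Ξ => (u ⟨(t, 0), hB 0⟩, u ⟨(t, 1), hB 1⟩) from
      (measurable_pi_apply _).prodMk (measurable_pi_apply _))
  convert hc using 1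
  · funext ω
    refine agdaIterates_congr _ fun i hi => ?_
    funext j
    have : (i, j) ∈ A := by simpa [A] using hi
    simp [past, this]
  · rfl

/-- Conditioning on the `t`-th iterate, the next one is obtained from two fresh samples. -/
theorem lintegral_iterate_succ [IsProbabilityMeasure P] [IsProbabilityMeasure ν]
    (hr : AGDARandomness P ν T ξ R)
    (hx : Measurable fun p : Vec d₁ × Vec d₂ × Ξ => Gx p.1 p.2.1 p.2.2)
    (hy : Measurable fun p : Vec d₁ × Vec d₂ × Ξ => Gy p.1 p.2.1 p.2.2) (t : Fin T)
    {φ : Vec d₁ × Vec d₂ → ℝ≥0∞} (hφ : Measurable φ) :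
    ∫⁻ ω, φ (agdaIterates Gx Gy τ₁ τ₂ x₀ y₀ (fun t j => ξ t j ω) t.succ) ∂P =
      ∫⁻ ω, ∫⁻ s₀, ∫⁻ s₁, φ (agdaStep Gx Gy τ₁ τ₂ ![s₀, s₁]
        (agdaIterates Gx Gy τ₁ τ₂ x₀ y₀ (fun t j => ξ t j ω) t.castSucc)) ∂ν ∂ν ∂P := by
  have hz : Measurable fun ω =>
      agdaIterates Gx Gy τ₁ τ₂ x₀ y₀ (fun t j => ξ t j ω) t.castSucc :=
    (measurable_agdaIterates hx hy _).comp hr.measurable_samples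
  have hs : Measurable fun ω => (ξ t 0 ω, ξ t 1 ω) :=
    (hr.measurable_sample t 0).prodMk (hr.measurable_sample t 1)
  have hF : Measurable fun q : (Vec d₁ × Vec d₂) × (Ξ × Ξ) =>
      φ (agdaStep Gx Gy τ₁ τ₂ ![q.2.1, q.2.2] q.1) := by
    have hvec : Measurable fun q : (Vec d₁ × Vec d₂) × (Ξ × Ξ) => ![q.2.1, q.2.2] :=
      measurable_pi_iff.2 (Fin.forall_fin_two.2 ⟨measurable_snd.fst, measurable_snd.snd⟩)
    exact hφ.comp ((measurable_agdaStep hx hy).comp (hvec.prodMk measurable_fst))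
  have hmap := (indepFun_iff_map_prod_eq_prod_map_map hz.aemeasurable hs.aemeasurable).1
    (hr.indepFun_iterate hx hy t)
  have : IsProbabilityMeasure (P.map fun ω =>
      agdaIterates Gx Gy τ₁ τ₂ x₀ y₀ (fun t j => ξ t j ω) t.castSucc) :=
    Measure.isProbabilityMeasure_map hz.aemeasurable
  calc _ = ∫⁻ ω, φ (agdaStep Gx Gy τ₁ τ₂ ![ξ t 0 ω, ξ t 1 ω]
        (agdaIterates Gx Gy τ₁ τ₂ x₀ y₀ (fun t j => ξ t j ω) t.castSucc)) ∂P := by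
        refine lintegral_congr fun ω => ?_
        rw [agdaIterates_succ]
        congr 2
        funext j
        fin_cases j <;> rfl
    _ = ∫⁻ q, φ (agdaStep Gx Gy τ₁ τ₂ ![q.2.1, q.2.2] q.1) ∂((P.map fun ω =>
        agdaIterates Gx Gy τ₁ τ₂ x₀ y₀ (fun t j => ξ t j ω) t.castSucc).prod (ν.prod ν)) := by
        rw [← hr.map_samples t, ← hmap, lintegral_map hF (hz.prodMk hs)]
    _ = ∫⁻ z, ∫⁻ s₀, ∫⁻ s₁, φ (agdaStep Gx Gy τ₁ τ₂ ![s₀, s₁] z) ∂ν ∂ν ∂(P.map fun ω =>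
        agdaIterates Gx Gy τ₁ τ₂ x₀ y₀ (fun t j => ξ t j ω) t.castSucc) := by
        rw [lintegral_prod _ hF.aemeasurable]
        refine lintegral_congr fun z => ?_
        exact lintegral_prod _ (hF.comp (measurable_prodMk_left (x := z))).aemeasurable
    _ = _ := by
        rw [lintegral_map _ hz]
        have h3 : Measurable fun q : ((Vec d₁ × Vec d₂) × Ξ) × Ξ =>
            φ (agdaStep Gx Gy τ₁ τ₂ ![q.1.2, q.2] q.1.1) :=
          hF.comp (measurable_fst.fst.prodMk (measurable_fst.snd.prodMk measurable_snd))
        exact h3.lintegral_prod_right'.lintegral_prod_right'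

theorem measurable_agdaOutput (hr : AGDARandomness P ν T ξ R)
    (hx : Measurable fun p : Vec d₁ × Vec d₂ × Ξ => Gx p.1 p.2.1 p.2.2)
    (hy : Measurable fun p : Vec d₁ × Vec d₂ × Ξ => Gy p.1 p.2.1 p.2.2) :
    Measurable (agdaOutput Gx Gy τ₁ τ₂ x₀ y₀ ξ R) := by
  have h : Measurable fun q : (Fin T → Fin 2 → Ξ) × Fin T =>
      agdaIterates Gx Gy τ₁ τ₂ x₀ y₀ q.1 q.2.castSucc :=
    measurable_from_prod_countable_left fun t => measurable_agdaIterates hx hy t.castSucc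
  exact h.comp (hr.measurable_samples.prodMk hr.measurable_index)

/-- The output is distributed as the average of the laws of the iterates. -/
theorem lintegral_output (hr : AGDARandomness P ν T ξ R)
    (hx : Measurable fun p : Vec d₁ × Vec d₂ × Ξ => Gx p.1 p.2.1 p.2.2)
    (hy : Measurable fun p : Vec d₁ × Vec d₂ × Ξ => Gy p.1 p.2.1 p.2.2)
    {φ : Vec d₁ × Vec d₂ → ℝ≥0∞} (hφ : Measurable φ) :
    ∫⁻ ω, φ (agdaOutput Gx Gy τ₁ τ₂ x₀ y₀ ξ R ω) ∂P = (T : ℝ≥0∞)⁻¹ *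
      ∑ t : Fin T,
        ∫⁻ ω, φ (agdaIterates Gx Gy τ₁ τ₂ x₀ y₀ (fun t j => ξ t j ω) t.castSucc) ∂P := by
  have hz : ∀ t : Fin T, Measurable fun s : Fin T → Fin 2 → Ξ =>
      φ (agdaIterates Gx Gy τ₁ τ₂ x₀ y₀ s t.castSucc) :=
    fun t => hφ.comp (measurable_agdaIterates hx hy _)
  have hi : ∀ t : Fin T, Measurable fun i : Fin T => if i = t then (1 : ℝ≥0∞) else 0 :=
    fun t => measurable_of_countable _
  -- Splitting over the value of R lets independence factor each term, with P(R = t) = 1/T.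
  have hsum : ∀ ω, φ (agdaOutput Gx Gy τ₁ τ₂ x₀ y₀ ξ R ω) = ∑ t : Fin T,
      (if R ω = t then (1 : ℝ≥0∞) else 0) *
        φ (agdaIterates Gx Gy τ₁ τ₂ x₀ y₀ (fun t j => ξ t j ω) t.castSucc) := by
    intro ω
    simp [agdaOutput]
  have hmR : ∀ t : Fin T, Measurable fun ω => if R ω = t then (1 : ℝ≥0∞) else 0 :=
    fun t => (hi t).comp hr.measurable_index
  have hprod : ∀ t : Fin T, Measurable fun ω => (if R ω = t then (1 : ℝ≥0∞) else 0) *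
      φ (agdaIterates Gx Gy τ₁ τ₂ x₀ y₀ (fun t j => ξ t j ω) t.castSucc) :=
    fun t => (hmR t).mul ((hz t).comp hr.measurable_samples)
  simp_rw [hsum]
  rw [lintegral_finsetSum _ fun t _ => hprod t, Finset.mul_sum]
  refine Finset.sum_congr rfl fun t _ => ?_
  have hmul := lintegral_mul_eq_lintegral_mul_lintegral_of_indepFun (hmR t)
    ((hz t).comp hr.measurable_samples) (hr.indep_index.comp (hi t) (hz t))
  refine hmul.trans ?_
  congr 1
  have : (fun ω => if R ω = t then (1 : ℝ≥0∞) else 0) = (R ⁻¹' {t}).indicator 1 := by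
    funext ω
    by_cases h : R ω = t <;> simp [h]
  rw [this, lintegral_indicator_one (hr.measurable_index (measurableSet_singleton t)),
    hr.uniform_index]

end AGDARandomness

/-- Telescoping in `ℝ≥0∞`, so that no integrability of the potential along the iterates has to be
established. -/
theorem sum_le_of_drift {T : ℕ} {e : Fin (T + 1) → ℝ≥0∞} {d : Fin T → ℝ≥0∞} {N : ℝ≥0∞}
    (h : ∀ t : Fin T, e t.succ + d t ≤ e t.castSucc + N) :
    e (Fin.last T) + ∑ t, d t ≤ e 0 + T * N := by
  induction T with
  | zero => simp
  | succ T ih =>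
    have h1 := ih (e := fun t => e t.castSucc) (d := fun t => d t.castSucc)
      fun t => h t.castSucc
    have h2 := h (Fin.last T)
    rw [Fin.succ_last] at h2
    rw [Fin.sum_univ_castSucc]
    calc _ = (e (Fin.last (T + 1)) + d (Fin.last T)) + ∑ t : Fin T, d t.castSucc := by ring
      _ ≤ e (Fin.last T).castSucc + N + ∑ t : Fin T, d t.castSucc := by gcongr
      _ = (e (Fin.last T).castSucc + ∑ t : Fin T, d t.castSucc) + N := by ring
      _ ≤ e 0 + T * N + N := add_le_add h1 le_rfl
      _ = _ := by push_cast; ring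

/-- A second moment bound gives a first moment bound. -/
theorem integrable_and_integral_le_of_sq [IsProbabilityMeasure P] {X : Ω → ℝ} (hX : Measurable X) (hX0 : ∀ ω, 0 ≤ X ω)
    {c ε : ℝ} (hc : 0 < c) (hε : 0 < ε)
    (h : ∫⁻ ω, ENNReal.ofReal (c * X ω ^ 2) ∂P ≤ ENNReal.ofReal (c * ε ^ 2)) :
    Integrable X P ∧ ∫ ω, X ω ∂P ≤ ε := by
  have hsq : Integrable (fun ω => c * X ω ^ 2) P := by
    refine ⟨((hX.pow_const 2).const_mul c).aestronglyMeasurable, ?_⟩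
    rw [hasFiniteIntegral_iff_ofReal (Filter.Eventually.of_forall fun ω => by positivity)]
    exact h.trans_lt ENNReal.ofReal_lt_top
  -- X ≤ X²/(2ε) + ε/2 gives integrability and the mean bound together.
  have hle : ∀ ω, X ω ≤ (2 * ε * c)⁻¹ * (c * X ω ^ 2) + ε / 2 := by
    intro ω
    have h1 : (2 * ε * c)⁻¹ * (c * X ω ^ 2) + ε / 2 - X ω = (X ω - ε) ^ 2 / (2 * ε) := by
      field_simp
      ring
    have h2 : 0 ≤ (X ω - ε) ^ 2 / (2 * ε) := by positivity
    linarith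
  have hb : Integrable (fun ω => (2 * ε * c)⁻¹ * (c * X ω ^ 2) + ε / 2) P :=
    (hsq.const_mul _).add (integrable_const _)
  have hXi : Integrable X P := hb.mono' hX.aestronglyMeasurable
    (Filter.Eventually.of_forall fun ω => by
      rw [Real.norm_of_nonneg (hX0 ω)]
      exact hle ω)
  refine ⟨hXi, (integral_mono hXi hb hle).trans ?_⟩
  have hI : ∫ ω, c * X ω ^ 2 ∂P ≤ c * ε ^ 2 := by
    rw [← ofReal_integral_eq_lintegral_ofReal hsq
      (Filter.Eventually.of_forall fun ω => by positivity)] at h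
    exact (ENNReal.ofReal_le_ofReal_iff (by positivity)).1 h
  rw [integral_add (hsq.const_mul _) (integrable_const _), integral_const_mul, integral_const]
  simp only [probReal_univ, one_smul]
  calc _ ≤ (2 * ε * c)⁻¹ * (c * ε ^ 2) + ε / 2 := by gcongr
    _ = ε := by field_simp; ring

/-- The mean squared gradient at the output, for step sizes in the ratio `68 κ²`. -/
theorem lintegral_output_le [IsProbabilityMeasure P] [IsProbabilityMeasure ν]
    {f : Vec d₁ → Vec d₂ → ℝ} {l μ σ Φstar : ℝ}
    (hf : LipschitzSmooth f l) (hp : PLInY f μ) (hμ : μ ≤ l)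
    (hG : StochasticGradients f ν Gx Gy σ) (hΦ : ∀ x, Φstar ≤ primal f x)
    (hτ : 0 < τ₂) (hτl : τ₂ ≤ 1 / l) (hτ₁ : τ₁ = τ₂ / (68 * (l / μ) ^ 2)) (hT : 0 < T)
    (hr : AGDARandomness P ν T ξ R) :
    ∫⁻ ω, ENNReal.ofReal (τ₁ / 4 *
      (‖gradX f (agdaOutput Gx Gy τ₁ τ₂ x₀ y₀ ξ R ω).1
          (agdaOutput Gx Gy τ₁ τ₂ x₀ y₀ ξ R ω).2‖ ^ 2
        + ‖gradY f (agdaOutput Gx Gy τ₁ τ₂ x₀ y₀ ξ R ω).1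
          (agdaOutput Gx Gy τ₁ τ₂ x₀ y₀ ξ R ω).2‖ ^ 2)) ∂P ≤
      ENNReal.ofReal (potential f Φstar (x₀, y₀) / T + l * τ₂ ^ 2 * σ ^ 2 / 8) := by
  have hl := hf.pos
  have hx := hG.measurable_Gx
  have hy := hG.measurable_Gy
  have hV : Measurable fun z => ENNReal.ofReal (potential f Φstar z) :=
    (measurable_potential hf hp).ennreal_ofReal
  have hS : Measurable fun z : Vec d₁ × Vec d₂ =>
      ENNReal.ofReal (τ₁ / 4 * (‖gradX f z.1 z.2‖ ^ 2 + ‖gradY f z.1 z.2‖ ^ 2)) := by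
    have h1 := hf.continuous_gradX
    have h2 := hf.continuous_gradY
    exact Measurable.ennreal_ofReal (Continuous.measurable (by fun_prop))
  have hz : ∀ t, Measurable fun ω => agdaIterates Gx Gy τ₁ τ₂ x₀ y₀ (fun t j => ξ t j ω) t :=
    fun t => (measurable_agdaIterates hx hy _).comp hr.measurable_samples
  have hSz : ∀ t : Fin T, Measurable fun ω => (fun z : Vec d₁ × Vec d₂ =>
      ENNReal.ofReal (τ₁ / 4 * (‖gradX f z.1 z.2‖ ^ 2 + ‖gradY f z.1 z.2‖ ^ 2)))
      (agdaIterates Gx Gy τ₁ τ₂ x₀ y₀ (fun t j => ξ t j ω) t.castSucc) :=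
    fun t => hS.comp (hz t.castSucc)
  have hsum := sum_le_of_drift (e := fun t => ∫⁻ ω, ENNReal.ofReal (potential f Φstar
      (agdaIterates Gx Gy τ₁ τ₂ x₀ y₀ (fun t j => ξ t j ω) t)) ∂P)
    (d := fun t => ∫⁻ ω, (fun z : Vec d₁ × Vec d₂ =>
      ENNReal.ofReal (τ₁ / 4 * (‖gradX f z.1 z.2‖ ^ 2 + ‖gradY f z.1 z.2‖ ^ 2)))
      (agdaIterates Gx Gy τ₁ τ₂ x₀ y₀ (fun t j => ξ t j ω) t.castSucc) ∂P)
    (N := ENNReal.ofReal (l * τ₂ ^ 2 * σ ^ 2 / 8)) (fun t => by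
      rw [hr.lintegral_iterate_succ hx hy t hV, ← lintegral_add_right _ (hSz t)]
      calc _ ≤ ∫⁻ ω, (ENNReal.ofReal (potential f Φstar
              (agdaIterates Gx Gy τ₁ τ₂ x₀ y₀ (fun t j => ξ t j ω) t.castSucc))
              + ENNReal.ofReal (l * τ₂ ^ 2 * σ ^ 2 / 8)) ∂P :=
            lintegral_mono fun ω => lintegral_potential_step_le hf hp hμ hG hΦ hτ hτl hτ₁ _ _
        _ = _ := by
          rw [lintegral_add_right _ measurable_const]
          simp)
  rw [hr.lintegral_output hx hy hS]
  have hT' : (0 : ℝ) < T := Nat.cast_pos.2 hT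
  have hN : 0 ≤ l * τ₂ ^ 2 * σ ^ 2 / 8 := by positivity
  -- The final potential is dropped.
  have hsum' := (le_add_left le_rfl).trans hsum
  simp only [agdaIterates_zero, lintegral_const, measure_univ, mul_one] at hsum'
  calc _ ≤ (T : ℝ≥0∞)⁻¹ * (ENNReal.ofReal (potential f Φstar (x₀, y₀)) +
        T * ENNReal.ofReal (l * τ₂ ^ 2 * σ ^ 2 / 8)) := by gcongr
    _ = ENNReal.ofReal ((T : ℝ)⁻¹ * (potential f Φstar (x₀, y₀)
        + T * (l * τ₂ ^ 2 * σ ^ 2 / 8))) := by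
      rw [ENNReal.ofReal_mul (by positivity), ENNReal.ofReal_inv_of_pos hT', ENNReal.ofReal_natCast,
        ENNReal.ofReal_add (potential_nonneg hp hΦ _) (by positivity),
        ENNReal.ofReal_mul (by positivity), ENNReal.ofReal_natCast]
    _ = _ := by
      congr 1
      field_simp

end Randomness

/-! ### Step sizes and iteration count -/

section StepSizes

variable {l κ σ Δ ε : ℝ} {T : ℕ}

/-- Both branches of the minima have the same ratio, as 17/68 = 1/4; hence the drift inequality
applies whichever branch is active. -/
theorem stepX_eq (hl : 0 < l) (hκ : 0 < κ) (hσ : 0 < σ) (hT : 0 < T) :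
    stepX l κ σ Δ T = stepY l σ Δ T / (68 * κ ^ 2) := by
  have hT' : (0 : ℝ) < T := Nat.cast_pos.2 hT
  have h : 0 < √(T * l) := Real.sqrt_pos.2 (by positivity)
  rw [stepX, stepY, ← min_div_div_right (by positivity)]
  congr 1
  · field_simp; ring
  · field_simp

theorem stepY_pos (hl : 0 < l) (hσ : 0 < σ) (hΔ : 0 < Δ) (hT : 0 < T) : 0 < stepY l σ Δ T := by
  have hT' : (0 : ℝ) < T := Nat.cast_pos.2 hT
  exact lt_min (by positivity) (by positivity)

/-- The iteration count that makes the averaged bound smaller than `τ₁ ε² / 4`. -/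
theorem averaged_bound_le {a₀ : ℝ} (hl : 0 < l) (hκ : 0 < κ) (hσ : 0 < σ) (hΔ : 0 < Δ)
    (ha : 0 ≤ a₀) (hε : 0 < ε) (hT : 0 < T)
    (hTC : 2000000 * ((1 + a₀ / Δ) * (l * κ ^ 2 * Δ / ε ^ 2)
      + (1 + a₀ / Δ) ^ 2 * (l * κ ^ 4 * Δ * σ ^ 2 / ε ^ 4)) ≤ (T : ℝ)) :
    (Δ + a₀ / 8) / T + l * stepY l σ Δ T ^ 2 * σ ^ 2 / 8 ≤ stepX l κ σ Δ T / 4 * ε ^ 2 := by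
  have hT' : (0 : ℝ) < T := Nat.cast_pos.2 hT
  obtain ⟨b, hb⟩ : ∃ b, b = 1 + a₀ / Δ := ⟨_, rfl⟩
  have hb1 : 1 ≤ b := by rw [hb]; have : 0 ≤ a₀ / Δ := by positivity
                         linarith
  have hbΔ : Δ + a₀ = b * Δ := by rw [hb]; field_simp
  rw [← hb] at hTC
  have hA : 0 ≤ b * (l * κ ^ 2 * Δ / ε ^ 2) := by positivity
  have hB : 0 ≤ b ^ 2 * (l * κ ^ 4 * Δ * σ ^ 2 / ε ^ 4) := by positivity
  have hT1 : 2000000 * (b * (l * κ ^ 2 * Δ)) ≤ ε ^ 2 * T := by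
    have : 2000000 * (b * (l * κ ^ 2 * Δ / ε ^ 2)) ≤ T := by linarith
    calc _ = ε ^ 2 * (2000000 * (b * (l * κ ^ 2 * Δ / ε ^ 2))) := by field_simp
      _ ≤ _ := by gcongr
  have hT2 : 2000000 * (b ^ 2 * (l * κ ^ 4 * Δ * σ ^ 2)) ≤ ε ^ 4 * T := by
    have : 2000000 * (b ^ 2 * (l * κ ^ 4 * Δ * σ ^ 2 / ε ^ 4)) ≤ T := by linarith
    calc _ = ε ^ 4 * (2000000 * (b ^ 2 * (l * κ ^ 4 * Δ * σ ^ 2 / ε ^ 4))) := by field_simp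
      _ ≤ _ := by gcongr
  obtain ⟨w, hw⟩ : ∃ w, w = √Δ / (σ * √(T * l)) := ⟨_, rfl⟩
  have hw0 : 0 < w := by rw [hw]; positivity
  have hw2 : w ^ 2 = Δ / (σ ^ 2 * (T * l)) := by
    rw [hw, div_pow, mul_pow, Real.sq_sqrt hΔ.le, Real.sq_sqrt (by positivity)]
  have hτ := stepX_eq (Δ := Δ) hl hκ hσ hT
  have hτ0 := stepY_pos hl hσ hΔ hT
  have hX : stepX l κ σ Δ T = min (w / (4 * κ ^ 2)) (1 / (68 * l * κ ^ 2)) := by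
    rw [stepX, hw]
    congr 1
    field_simp
  have hYw : stepY l σ Δ T ≤ 17 * w := by
    refine (min_le_left _ _).trans (le_of_eq ?_)
    rw [hw]
    ring
  -- The initial potential gets half the budget τ₁ε²/4. The noise branch of τ₁ needs the ε⁻⁴ part of
  -- the bound on T, the other branch the ε⁻² part.
  have h1 : 8 * (b * Δ) / T ≤ stepX l κ σ Δ T * ε ^ 2 := by
    rw [hX, min_mul_of_nonneg _ _ (by positivity)]
    refine le_min ?_ ?_
    · rw [div_le_iff₀ hT', div_mul_eq_mul_div, div_mul_eq_mul_div, le_div_iff₀ (by positivity)]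
      refine le_of_sq_le_sq ?_ (by positivity)
      have : (w * ε ^ 2 * T) ^ 2 = Δ / (σ ^ 2 * l) * (ε ^ 4 * T) := by
        rw [mul_pow, mul_pow, hw2]
        field_simp
      rw [this]
      calc _ = Δ / (σ ^ 2 * l) * (1024 * (b ^ 2 * (l * κ ^ 4 * Δ * σ ^ 2))) := by
            field_simp
            ring
        _ ≤ _ := by
            refine mul_le_mul_of_nonneg_left (le_trans ?_ hT2) (by positivity)
            gcongr
            norm_num
    · rw [div_le_iff₀ hT', div_mul_eq_mul_div, div_mul_eq_mul_div, le_div_iff₀ (by positivity)]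
      have : 0 ≤ b * (l * κ ^ 2 * Δ) := by positivity
      linarith
  -- Here 1156 = 68 · 17, and 1156² = 1336336 is the largest constant that 2000000 has to dominate.
  have h2 : 1156 * (κ ^ 2 * l * σ ^ 2) * w ≤ ε ^ 2 := by
    refine le_of_sq_le_sq ?_ (by positivity)
    rw [mul_pow, hw2]
    have : 0 ≤ l * κ ^ 4 * Δ * σ ^ 2 := by positivity
    have hbb : l * κ ^ 4 * Δ * σ ^ 2 ≤ b ^ 2 * (l * κ ^ 4 * Δ * σ ^ 2) :=
      le_mul_of_one_le_left this (one_le_pow₀ hb1)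
    calc _ = 1336336 * (l * κ ^ 4 * Δ * σ ^ 2) / T := by
          field_simp
          norm_num
      _ ≤ ε ^ 4 := by
          rw [div_le_iff₀ hT']
          linarith
      _ = _ := by ring
  -- One factor τ₂ is kept, since τ₁ is proportional to it; the other is bounded by 17w.
  have h3 : l * stepY l σ Δ T ^ 2 * σ ^ 2 ≤ stepX l κ σ Δ T * ε ^ 2 := by
    rw [hτ, div_mul_eq_mul_div, le_div_iff₀ (by positivity)]
    calc _ = stepY l σ Δ T * (68 * (κ ^ 2 * l * σ ^ 2) * stepY l σ Δ T) := by ring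
      _ ≤ stepY l σ Δ T * (68 * (κ ^ 2 * l * σ ^ 2) * (17 * w)) := by gcongr
      _ = stepY l σ Δ T * (1156 * (κ ^ 2 * l * σ ^ 2) * w) := by ring
      _ ≤ _ := by gcongr
  have h4 : (Δ + a₀ / 8) / T ≤ 8 * (b * Δ) / T / 8 := by
    rw [div_right_comm]
    gcongr
    linarith
  linarith

end StepSizes

end MinimaxPL

/-! ### The main theorem -/

theorem corollary1 :
    ∃ C : ℝ, 0 < C ∧
      ∀ (d₁ d₂ : ℕ) (f : MinimaxPL.Vec d₁ → MinimaxPL.Vec d₂ → ℝ) (l μ σ Φstar : ℝ)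
        (Ξ : Type*) (_ : MeasurableSpace Ξ) (ν : Measure Ξ) (_ : IsProbabilityMeasure ν)
        (Gx : MinimaxPL.Vec d₁ → MinimaxPL.Vec d₂ → Ξ → MinimaxPL.Vec d₁)
        (Gy : MinimaxPL.Vec d₁ → MinimaxPL.Vec d₂ → Ξ → MinimaxPL.Vec d₂),
        MinimaxPL.LipschitzSmooth f l →
        MinimaxPL.PLInY f μ →
        MinimaxPL.StochasticGradients f ν Gx Gy σ →
        μ ≤ l →
        (∀ x, Φstar ≤ MinimaxPL.primal f x) →
        ∀ (x₀ : MinimaxPL.Vec d₁) (y₀ : MinimaxPL.Vec d₂) (κ Δ a₀ ε : ℝ),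
          κ = l / μ →
          Δ = MinimaxPL.primal f x₀ - Φstar →
          0 < Δ →
          a₀ = MinimaxPL.primal f x₀ - f x₀ y₀ →
          0 < ε →
          ∀ (T : ℕ),
            C * ((1 + a₀ / Δ) * (l * κ ^ 2 * Δ / ε ^ 2)
              + (1 + a₀ / Δ) ^ 2 * (l * κ ^ 4 * Δ * σ ^ 2 / ε ^ 4)) ≤ (T : ℝ) →
            ∀ (Ω : Type*) (_ : MeasurableSpace Ω) (P : Measure Ω) (_ : IsProbabilityMeasure P)
              (ξ : Fin T → Fin 2 → Ω → Ξ) (R : Ω → Fin T),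
              MinimaxPL.AGDARandomness P ν T ξ R →
              ∀ (out : Ω → MinimaxPL.Vec d₁ × MinimaxPL.Vec d₂),
                out = MinimaxPL.agdaOutput Gx Gy (MinimaxPL.stepX l κ σ Δ T)
                  (MinimaxPL.stepY l σ Δ T) x₀ y₀ ξ R →
                (Integrable (fun ω => ‖MinimaxPL.gradX f (out ω).1 (out ω).2‖) P ∧
                  ∫ ω, ‖MinimaxPL.gradX f (out ω).1 (out ω).2‖ ∂P ≤ ε) ∧
                (Integrable (fun ω => ‖MinimaxPL.gradY f (out ω).1 (out ω).2‖) P ∧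
                  ∫ ω, ‖MinimaxPL.gradY f (out ω).1 (out ω).2‖ ∂P ≤ ε) := by
  refine ⟨2000000, by norm_num, ?_⟩
  intro d₁ d₂ f l μ σ Φstar Ξ _ ν _ Gx Gy hf hp hG hμ hΦ x₀ y₀ κ Δ a₀ ε hκ hΔ hΔ0 ha₀ hε T hT
    Ω _ P _ ξ R hr out hout
  have hl := hf.pos
  have hμ0 := hp.pos
  have hσ := hG.pos
  have hκ0 : 0 < κ := by rw [hκ]; positivity
  have ha0 : 0 ≤ a₀ := by rw [ha₀]; exact sub_nonneg.2 (hp.le_primal x₀ y₀)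
  have hT0 : 0 < T := by
    refine Nat.cast_pos.1 (lt_of_lt_of_le ?_ hT)
    positivity
  have hτ₁ := MinimaxPL.stepX_eq (Δ := Δ) hl hκ0 hσ hT0
  have hτ₂ := MinimaxPL.stepY_pos hl hσ hΔ0 hT0
  have hτ₁0 : 0 < MinimaxPL.stepX l κ σ Δ T := by rw [hτ₁]; positivity
  have hbound := MinimaxPL.averaged_bound_le hl hκ0 hσ hΔ0 ha0 hε hT0 hT
  have hpot : MinimaxPL.potential f Φstar (x₀, y₀) = Δ + a₀ / 8 := by
    rw [hΔ, ha₀, MinimaxPL.potential]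
  have hmain := MinimaxPL.lintegral_output_le (τ₁ := MinimaxPL.stepX l κ σ Δ T) (x₀ := x₀) (y₀ := y₀)
    hf hp hμ hG hΦ hτ₂ (min_le_right _ _) (by rw [hτ₁, hκ]) hT0 hr
  rw [← hout, hpot] at hmain
  have hmain' := hmain.trans (ENNReal.ofReal_le_ofReal hbound)
  have hmout : Measurable out := by
    have hz := hr.measurable_agdaOutput (τ₁ := MinimaxPL.stepX l κ σ Δ T)
      (τ₂ := MinimaxPL.stepY l σ Δ T) (x₀ := x₀) (y₀ := y₀) hG.measurable_Gx hG.measurable_Gy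
    rwa [hout]
  constructor
  · refine MinimaxPL.integrable_and_integral_le_of_sq
      (hf.continuous_gradX.norm.measurable.comp hmout) (fun _ => norm_nonneg _)
      (c := MinimaxPL.stepX l κ σ Δ T / 4) (by positivity) hε (le_trans ?_ hmain')
    refine lintegral_mono fun ω => ENNReal.ofReal_le_ofReal ?_
    gcongr
    exact le_add_of_nonneg_right (by positivity)
  · refine MinimaxPL.integrable_and_integral_le_of_sq
      (hf.continuous_gradY.norm.measurable.comp hmout) (fun _ => norm_nonneg _)
      (c := MinimaxPL.stepX l κ σ Δ T / 4) (by positivity) hε (le_trans ?_ hmain')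
    refine lintegral_mono fun ω => ENNReal.ofReal_le_ofReal ?_
    gcongr
    exact le_add_of_nonneg_left (by positivity)
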